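/- For $n\ge 0$ write $[n]=\{1,\dots,n\}$, and let $Q_n$ be the $n$-cube: the graph whose vertices are the subsets of $[n]$, where $X$ and $Y$ are adjacent iff $X\oplus Y=\{i\}$ for some $i\in[n]$, called the direction of the edge $\{X,Y\}$ (here $\oplus$ is symmetric difference). The signature of a spanning tree $T$ of $Q_n$ is $\operatorname{sig}(T)=(a_1,\dots,a_n)$, where $a_i$ is the number of edges of $T$ in direction $i$; an $n$-tuple is a signature of $Q_n$ if it is $\operatorname{sig}(T)$ for some spanning tree $T$ of $Q_n$, and it is ordered if $a_1\le\dots\le a_n$. Let $\sigma_i$ be the automorphism $X\mapsto X\oplus\{i\}$ of $Q_n$. A spanning tree $T'$ is obtained from a spanning tree $T$ by an edge slide if $T'=T-e+\sigma_i(e)$ for some $i\in[n]$ and some edge $e$ of $T$ in a direction $j\ne i$ such that $\sigma_i(e)$ is not an edge of $T$. The edge slide graph of $Q_n$ has the spanning trees of $Q_n$ as vertices, two being adjacent iff one is obtained from the other by an edge slide; for an $n$-tuple $\mathcal S$ let $\mathcal E(\mathcal S)$ be its subgraph induced by the spanning trees with signature $\mathcal S$. For a signature $\mathcal S=(a_1,\dots,a_n)$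 and $1\le k\le n$ the excess of $\mathcal S$ at $k$ is $$\varepsilon_k(\mathcal S)=\min_{K\subseteq[n],\ |K|=k}\Bigl(\sum_{i\in K}a_i\Bigr)-(2^k-1).$$ For $1\le r\le n$, an ordered signature $\mathcal S$ of $Q_n$ is saturated above direction $r$ if $\varepsilon_k(\mathcal S)=0$ for all $r\le k\le n$. The unsaturated part of an ordered signature $\mathcal S$ is $\operatorname{unsat}(\mathcal S)=(a_1,\dots,a_s)$, where $s$ is the least index with $1\le s\le n$ such that $\varepsilon_k(\mathcal S)=0$ for all $s\le k\le n$. **Theorem.** Let $1\le r\le n$ and let the ordered signature $\mathcal S=(a_1,\dots,a_n)$ of $Q_n$ be saturated above direction $r$. Then $\mathcal E(\mathcal S)$ is connected if and only if $\mathcal E(a_1,\dots,a_r)$ is connected. In particular, $\mathcal E(\mathcal S)$ is connected if and only if $\mathcal E(\operatorname{unsat}(\mathcal S))$ is connected. -/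

import Mathlib

namespace CubeTree

/-- The `n`-cube `Q_n`: vertices are the subsets of the set of directions `Fin n` (playing the
role of `[n]`), and two vertices are adjacent iff they differ in exactly one element. -/
def cube (n : ℕ) : SimpleGraph (Finset (Fin n)) where
  Adj X Y := ∃ i, symmDiff X Y = {i}
  symm := ⟨by
    rintro X Y ⟨i, h⟩
    exact ⟨i, by rw [symmDiff_comm, h]⟩⟩
  loopless := ⟨by
    rintro X ⟨i, h⟩
    rw [symmDiff_self] at h
    exact (Finset.singleton_ne_empty i) h.symm⟩

/-- The edge `e` has direction `i`: its ends `X`, `Y` satisfy `X ⊕ Y = {i}`. -/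
def HasDirection {n : ℕ} (e : Sym2 (Finset (Fin n))) (i : Fin n) : Prop :=
  ∃ X Y : Finset (Fin n), e = s(X, Y) ∧ symmDiff X Y = {i}

/-- The spanning trees of `Q_n`. -/
abbrev SpanningTree (n : ℕ) : Type :=
  {T : SimpleGraph (Finset (Fin n)) // T ≤ cube n ∧ T.IsTree}

/-- The signature of a spanning tree: the `i`-th entry is the number of edges of `T` in
direction `i`. -/
noncomputable def sig {n : ℕ} (T : SpanningTree n) : Fin n → ℕ :=
  fun i => Set.ncard {e | e ∈ T.1.edgeSet ∧ HasDirection e i}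

/-- `S` is a signature of `Q_n`. -/
def IsSignature {n : ℕ} (S : Fin n → ℕ) : Prop :=
  ∃ T : SpanningTree n, sig T = S

/-- A tuple is ordered if its entries are nondecreasing. -/
def IsOrdered {n : ℕ} (S : Fin n → ℕ) : Prop :=
  ∀ i j : Fin n, i ≤ j → S i ≤ S j

/-- The map `σ_i : X ↦ X ⊕ {i}` on the vertices of `Q_n`. -/
def flip {n : ℕ} (i : Fin n) (X : Finset (Fin n)) : Finset (Fin n) :=
  symmDiff X {i}

/-- The map `σ_i` on edges. -/
def flipEdge {n : ℕ} (i : Fin n) (e : Sym2 (Finset (Fin n))) : Sym2 (Finset (Fin n)) :=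
  e.map (flip i)

theorem flipEdge_flipEdge {n : ℕ} (i : Fin n) (e : Sym2 (Finset (Fin n))) :
    flipEdge i (flipEdge i e) = e := by
  induction e using Sym2.ind with
  | _ X Y => simp [flipEdge, flip]

theorem HasDirection.flipEdge {n : ℕ} {e : Sym2 (Finset (Fin n))} {j : Fin n}
    (h : HasDirection e j) (i : Fin n) : HasDirection (flipEdge i e) j := by
  obtain ⟨X, Y, rfl, h⟩ := h
  refine ⟨flip i X, flip i Y, rfl, ?_⟩
  rw [flip, flip, symmDiff_comm Y, symmDiff_assoc, symmDiff_symmDiff_cancel_left, h]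

/-- `T'` is obtained from `T` by sliding in direction `i` the edge `e` of `T`: `e` has a direction
`j ≠ i`, the edge `σ_i(e)` is not in `T`, and `T' = T - e + σ_i(e)`.  That the result is again a
spanning tree is part of the type of `T'`. -/
def IsSlide {n : ℕ} (T T' : SpanningTree n) (e : Sym2 (Finset (Fin n))) (i : Fin n) : Prop :=
  e ∈ T.1.edgeSet ∧ (∃ j, j ≠ i ∧ HasDirection e j) ∧ flipEdge i e ∉ T.1.edgeSet ∧
    T'.1.edgeSet = insert (flipEdge i e) (T.1.edgeSet \ {e})

theorem IsSlide.reverse {n : ℕ} {T T' : SpanningTree n} {e : Sym2 (Finset (Fin n))} {i : Fin n}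
    (h : IsSlide T T' e i) : IsSlide T' T (flipEdge i e) i := by
  obtain ⟨he, ⟨j, hj, hd⟩, hf, hT⟩ := h
  have hne : e ≠ flipEdge i e := fun h' => hf (h' ▸ he)
  refine ⟨by simp [hT], ⟨j, hj, hd.flipEdge i⟩, ?_, ?_⟩
  · rw [flipEdge_flipEdge, hT]
    simp [hne]
  · rw [flipEdge_flipEdge, hT]
    ext x
    simp only [Set.mem_insert_iff, Set.mem_sdiff, Set.mem_singleton_iff]
    constructor
    · intro hx
      by_cases hxe : x = e
      · exact Or.inl hxe
      · exact Or.inr ⟨Or.inr ⟨hx, hxe⟩, fun h' => hf (h' ▸ hx)⟩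
    · rintro (rfl | ⟨h1 | h1, h2⟩)
      · exact he
      · exact absurd h1 h2
      · exact h1.1

/-- The edge slide graph `E(Q_n)`: vertices are the spanning trees of `Q_n`, and `T`, `T'` are
adjacent iff `T'` is obtained from `T` by a single edge slide. -/
def edgeSlideGraph (n : ℕ) : SimpleGraph (SpanningTree n) where
  Adj T T' := ∃ e i, IsSlide T T' e i
  symm := ⟨by
    rintro T T' ⟨e, i, h⟩
    exact ⟨_, i, h.reverse⟩⟩
  loopless := ⟨by
    rintro T ⟨e, i, -, -, hf, hT⟩
    exact hf (by rw [hT]; exact Set.mem_insert _ _)⟩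

/-- The edge slide graph `E(S)`: the subgraph of `E(Q_n)` induced by the spanning trees with
signature `S`. -/
def edgeSlideGraphSig {n : ℕ} (S : Fin n → ℕ) : SimpleGraph {T : SpanningTree n | sig T = S} :=
  (edgeSlideGraph n).induce {T : SpanningTree n | sig T = S}

/-- The excess of `S` at `k`: the minimum of `∑ i ∈ K, S i` over the `k`-element sets `K` of
directions, minus `2 ^ k - 1`.  It is used for `1 ≤ k ≤ n` only, where such sets `K` exist. -/
noncomputable def excess {n : ℕ} (S : Fin n → ℕ) (k : ℕ) : ℤ :=
  ((sInf {m : ℕ | ∃ K : Finset (Fin n), K.card = k ∧ ∑ i ∈ K, S i = m} : ℕ) : ℤ) - (2 ^ k - 1)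

/-- `S` has excess zero at every `k` with `r ≤ k ≤ n`.  For an ordered signature `S` this says
that `S` is saturated above direction `r`. -/
def SaturatedAbove {n : ℕ} (S : Fin n → ℕ) (r : ℕ) : Prop :=
  ∀ k : ℕ, r ≤ k → k ≤ n → excess S k = 0

/-- The initial segment `(a_1, …, a_r)` of `S = (a_1, …, a_n)`. -/
def initial {n : ℕ} (S : Fin n → ℕ) (r : ℕ) (hr : r ≤ n) : Fin r → ℕ :=
  fun i => S (Fin.castLE hr i)

/-- The least `s` with `1 ≤ s ≤ n` such that the excess of `S` is zero at all `k` with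
`s ≤ k ≤ n`. -/
noncomputable def unsatIndex {n : ℕ} (S : Fin n → ℕ) : ℕ :=
  sInf {s : ℕ | 1 ≤ s ∧ s ≤ n ∧ SaturatedAbove S s}

theorem unsatIndex_le {n : ℕ} (S : Fin n → ℕ) : unsatIndex S ≤ n := by
  rcases Set.eq_empty_or_nonempty {s : ℕ | 1 ≤ s ∧ s ≤ n ∧ SaturatedAbove S s} with h | h
  · simp [unsatIndex, h]
  · exact (Nat.sInf_mem h).2.1

/-- The unsaturated part of an ordered signature `S`: its initial segment `(a_1, …, a_s)`, where
`s = unsatIndex S`. -/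
noncomputable def unsat {n : ℕ} (S : Fin n → ℕ) : Fin (unsatIndex S) → ℕ :=
  initial S (unsatIndex S) (unsatIndex_le S)

end CubeTree

namespace CubeTree

/-! For an ordered tuple the minimum in the excess is attained on the initial segment, so zero
excess at `k` and `k + 1` forces the entry in direction `k + 1` to be `2 ^ k`
(`SaturatedAbove.apply_eq`): a tree with the truncated signature contains every edge in its last
direction. It remains to remove one such direction (`connected_iff_of_last`) and induct.

A subgraph of `Q_{n+1}` with all last-direction edges is a tree iff its two layers are disjoint and
their union is a spanning tree of `Q_n` (`IsFull.isTree_iff`). Such a tree is thus a spanning tree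
of `Q_n` with a free choice of layer for each edge. Slides in the last direction change these
choices one at a time, and all other slides contract to slides of `Q_n`. Contraction therefore has
connected fibres, and slides of `Q_n` lift to the trees with empty upper layer. -/

variable {n : ℕ}

/-! ### Splitting the cube along its last direction -/

/-- The vertex of `Q_{n+1}` lying over the vertex `X` of `Q_n`, in the upper copy of `Q_n` if `b`
is true and in the lower copy otherwise. -/
def lift (b : Bool) (X : Finset (Fin n)) : Finset (Fin (n + 1)) :=
  X.map Fin.castSuccEmb ∪ if b then {Fin.last n} else ∅

/-- The projection of `Q_{n+1}` to `Q_n` that forgets the last direction. -/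
def proj (A : Finset (Fin (n + 1))) : Finset (Fin n) :=
  Finset.univ.filter fun i => i.castSucc ∈ A

@[simp]
theorem castSucc_mem_lift {b : Bool} {X : Finset (Fin n)} {i : Fin n} :
    i.castSucc ∈ lift b X ↔ i ∈ X := by
  cases b <;> simp [lift, Fin.castSucc_ne_last]

@[simp]
theorem last_mem_lift {b : Bool} {X : Finset (Fin n)} : Fin.last n ∈ lift b X ↔ b = true := by
  cases b <;> simp [lift, Fin.castSucc_ne_last]

@[simp]
theorem proj_lift (b : Bool) (X : Finset (Fin n)) : proj (lift b X) = X := by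
  ext i; simp [proj]

theorem exists_eq_lift (A : Finset (Fin (n + 1))) : ∃ b X, A = lift b X := by
  refine ⟨decide (Fin.last n ∈ A), proj A, ?_⟩
  ext i
  induction i using Fin.lastCases <;> simp [proj]

@[simp]
theorem lift_inj {a b : Bool} {X Y : Finset (Fin n)} : lift a X = lift b Y ↔ a = b ∧ X = Y := by
  refine ⟨fun h => ⟨?_, by simpa using congrArg proj h⟩, fun ⟨h, h'⟩ => by rw [h, h']⟩
  rw [Bool.eq_iff_iff, ← last_mem_lift (X := X), h, last_mem_lift]

theorem lift_injective (b : Bool) : Function.Injective (lift (n := n) b) :=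
  fun _ _ h => (lift_inj.1 h).2

theorem symmDiff_lift (a b : Bool) (X Y : Finset (Fin n)) :
    symmDiff (lift a X) (lift b Y) = lift (xor a b) (symmDiff X Y) := by
  ext i
  induction i using Fin.lastCases with
  | last => cases a <;> cases b <;> simp [Finset.mem_symmDiff]
  | cast i => simp [Finset.mem_symmDiff]

theorem singleton_castSucc (i : Fin n) : ({i.castSucc} : Finset (Fin (n + 1))) = lift false {i} := by
  simp [lift]

theorem singleton_last : ({Fin.last n} : Finset (Fin (n + 1))) = lift true ∅ := by
  simp [lift]

theorem flip_last_lift (b : Bool) (X : Finset (Fin n)) :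
    flip (Fin.last n) (lift b X) = lift (!b) X := by
  rw [flip, singleton_last, symmDiff_lift]
  simp [← Finset.bot_eq_empty]

theorem flip_castSucc_lift (i : Fin n) (b : Bool) (X : Finset (Fin n)) :
    flip i.castSucc (lift b X) = lift b (flip i X) := by
  rw [flip, singleton_castSucc, symmDiff_lift, flip, Bool.xor_false]

theorem flipEdge_last_map_lift (b : Bool) (e : Sym2 (Finset (Fin n))) :
    flipEdge (Fin.last n) (e.map (lift b)) = e.map (lift !b) := by
  induction e using Sym2.ind with
  | _ X Y => simp [flipEdge, flip_last_lift]

theorem flipEdge_castSucc_map_lift (i : Fin n) (b : Bool) (e : Sym2 (Finset (Fin n))) :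
    flipEdge i.castSucc (e.map (lift b)) = (flipEdge i e).map (lift b) := by
  induction e using Sym2.ind with
  | _ X Y => simp [flipEdge, flip_castSucc_lift]

theorem hasDirection_mk {X Y : Finset (Fin n)} {i : Fin n} :
    HasDirection s(X, Y) i ↔ symmDiff X Y = {i} := by
  constructor
  · rintro ⟨A, B, h, h'⟩
    rcases Sym2.eq_iff.1 h with ⟨rfl, rfl⟩ | ⟨rfl, rfl⟩
    · exact h'
    · rwa [symmDiff_comm]
  · exact fun h => ⟨X, Y, rfl, h⟩

theorem hasDirection_of_mem {T : SimpleGraph (Finset (Fin n))} (hT : T ≤ cube n)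
    {e : Sym2 (Finset (Fin n))} (he : e ∈ T.edgeSet) : ∃ i, HasDirection e i := by
  induction e using Sym2.ind with
  | _ X Y =>
    obtain ⟨i, hi⟩ := hT he
    exact ⟨i, hasDirection_mk.2 hi⟩

theorem hasDirection_castSucc_iff {e : Sym2 (Finset (Fin (n + 1)))} {i : Fin n} :
    HasDirection e i.castSucc ↔ ∃ b f, HasDirection f i ∧ e = f.map (lift b) := by
  induction e using Sym2.ind with
  | _ A B =>
    obtain ⟨a, X, rfl⟩ := exists_eq_lift A
    obtain ⟨b, Y, rfl⟩ := exists_eq_lift B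
    rw [hasDirection_mk, singleton_castSucc, symmDiff_lift, lift_inj]
    constructor
    · rintro ⟨h, h'⟩
      obtain rfl : a = b := by simpa using h
      exact ⟨a, s(X, Y), hasDirection_mk.2 h', rfl⟩
    · rintro ⟨c, f, hf, h⟩
      induction f using Sym2.ind with
      | _ Z W =>
        rw [hasDirection_mk] at hf
        simp only [Sym2.map_mk, Sym2.eq_iff, lift_inj] at h
        rcases h with ⟨⟨rfl, rfl⟩, rfl, rfl⟩ | ⟨⟨rfl, rfl⟩, rfl, rfl⟩
        · simp [hf]
        · rw [symmDiff_comm]; simp [hf]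

theorem hasDirection_map_lift {e : Sym2 (Finset (Fin n))} {i : Fin n} {b : Bool} :
    HasDirection (e.map (lift b)) i.castSucc ↔ HasDirection e i := by
  induction e using Sym2.ind with
  | _ X Y =>
    simp [hasDirection_mk, singleton_castSucc, symmDiff_lift]

/-- The edge of `Q_{n+1}` in the last direction lying over the vertex `X` of `Q_n`. -/
def vertical (X : Finset (Fin n)) : Sym2 (Finset (Fin (n + 1))) :=
  s(lift false X, lift true X)

theorem vertical_injective : Function.Injective (vertical (n := n)) := by
  intro X Y h
  simpa [vertical] using h

theorem map_lift_ne_vertical (b : Bool) (e : Sym2 (Finset (Fin n))) (X : Finset (Fin n)) :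
    e.map (lift b) ≠ vertical X := by
  induction e using Sym2.ind with
  | _ Y Z => cases b <;> simp [vertical]

theorem map_lift_inj {a b : Bool} {e f : Sym2 (Finset (Fin n))} :
    e.map (lift a) = f.map (lift b) ↔ a = b ∧ e = f := by
  constructor
  · intro h
    have hab : a = b := by
      induction e using Sym2.ind with
      | _ X Y =>
        induction f using Sym2.ind with
        | _ Z W =>
          simp only [Sym2.map_mk, Sym2.eq_iff, lift_inj] at h
          rcases h with ⟨⟨h, -⟩, -⟩ | ⟨⟨h, -⟩, -⟩ <;> exact h
    subst hab
    exact ⟨rfl, Sym2.map.injective (lift_injective a) h⟩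
  · rintro ⟨rfl, rfl⟩
    rfl

theorem hasDirection_last_iff {e : Sym2 (Finset (Fin (n + 1)))} :
    HasDirection e (Fin.last n) ↔ e ∈ Set.range vertical := by
  induction e using Sym2.ind with
  | _ A B =>
    obtain ⟨a, X, rfl⟩ := exists_eq_lift A
    obtain ⟨b, Y, rfl⟩ := exists_eq_lift B
    rw [hasDirection_mk, singleton_last, symmDiff_lift, lift_inj, ← Finset.bot_eq_empty,
      symmDiff_eq_bot]
    cases a <;> cases b <;> simp [vertical, eq_comm]

theorem ncard_range_vertical : (Set.range (vertical (n := n))).ncard = 2 ^ n := by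
  rw [← Nat.card_coe_set_eq, Nat.card_range_of_injective vertical_injective]
  simp

/-! ### Contraction of the last direction -/

/-- A subgraph of `Q_{n+1}` containing all edges in the last direction. -/
structure IsFull (G : SimpleGraph (Finset (Fin (n + 1)))) : Prop where
  le : G ≤ cube (n + 1)
  vertical_mem : ∀ X, vertical X ∈ G.edgeSet

/-- The set of edges of the lower or upper layer of `G`, as edges of `Q_n`. -/
def layer (G : SimpleGraph (Finset (Fin (n + 1)))) (b : Bool) : Set (Sym2 (Finset (Fin n))) :=
  {e | e.map (lift b) ∈ G.edgeSet}

theorem mem_layer {G : SimpleGraph (Finset (Fin (n + 1)))} {b : Bool}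
    {e : Sym2 (Finset (Fin n))} : e ∈ layer G b ↔ e.map (lift b) ∈ G.edgeSet :=
  Iff.rfl

/-- The graph on the vertices of `Q_n` obtained from `G` by contracting the last direction. -/
def contract (G : SimpleGraph (Finset (Fin (n + 1)))) : SimpleGraph (Finset (Fin n)) :=
  G.comap (lift false) ⊔ G.comap (lift true)

theorem contract_adj {G : SimpleGraph (Finset (Fin (n + 1)))} {X Y : Finset (Fin n)} :
    (contract G).Adj X Y ↔ ∃ b, G.Adj (lift b X) (lift b Y) := by
  simp [contract]

theorem mem_contract {G : SimpleGraph (Finset (Fin (n + 1)))} {e : Sym2 (Finset (Fin n))} :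
    e ∈ (contract G).edgeSet ↔ ∃ b, e ∈ layer G b := by
  induction e using Sym2.ind with
  | _ X Y => simpa [mem_layer] using contract_adj

theorem edgeSet_contract (G : SimpleGraph (Finset (Fin (n + 1)))) :
    (contract G).edgeSet = layer G false ∪ layer G true := by
  ext e
  simp [mem_contract]

theorem contract_le {G : SimpleGraph (Finset (Fin (n + 1)))} (hG : G ≤ cube (n + 1)) :
    contract G ≤ cube n := by
  intro X Y h
  obtain ⟨b, h⟩ := contract_adj.1 h
  obtain ⟨i, hi⟩ := hG h
  rw [symmDiff_lift] at hi
  induction i using Fin.lastCases with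
  | last => simp [singleton_last] at hi
  | cast i => exact ⟨i, by simpa [singleton_castSucc] using hi⟩

theorem eq_vertical_or_eq_map_lift {e : Sym2 (Finset (Fin (n + 1)))} {i : Fin (n + 1)}
    (h : HasDirection e i) : e ∈ Set.range vertical ∨ ∃ b, ∃ f : Sym2 (Finset (Fin n)), e = f.map (lift b) := by
  induction i using Fin.lastCases with
  | last => exact Or.inl (hasDirection_last_iff.1 h)
  | cast i =>
    obtain ⟨b, f, -, rfl⟩ := hasDirection_castSucc_iff.1 h
    exact Or.inr ⟨b, f, rfl⟩

theorem IsFull.edgeSet_eq {G : SimpleGraph (Finset (Fin (n + 1)))} (hG : IsFull G) :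
    G.edgeSet = Set.range vertical ∪ (Sym2.map (lift false) '' layer G false ∪
      Sym2.map (lift true) '' layer G true) := by
  ext e
  constructor
  · intro he
    obtain ⟨i, hi⟩ := hasDirection_of_mem hG.le he
    rcases eq_vertical_or_eq_map_lift hi with h | ⟨b, f, rfl⟩
    · exact Or.inl h
    · cases b
      · exact Or.inr (Or.inl ⟨f, he, rfl⟩)
      · exact Or.inr (Or.inr ⟨f, he, rfl⟩)
  · rintro (⟨X, rfl⟩ | ⟨f, hf, rfl⟩ | ⟨f, hf, rfl⟩)
    · exact hG.vertical_mem X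
    · exact hf
    · exact hf

theorem disjoint_image_lift (s t : Set (Sym2 (Finset (Fin n)))) :
    Disjoint (Sym2.map (lift false) '' s) (Sym2.map (lift true) '' t) := by
  rw [Set.disjoint_left]
  rintro _ ⟨e, -, rfl⟩ ⟨f, -, h⟩
  simpa using (map_lift_inj.1 h).1

theorem ncard_image_lift (b : Bool) (s : Set (Sym2 (Finset (Fin n)))) :
    (Sym2.map (lift b) '' s).ncard = s.ncard :=
  Set.ncard_image_of_injective _ (Sym2.map.injective (lift_injective b))

theorem IsFull.ncard_edgeSet {G : SimpleGraph (Finset (Fin (n + 1)))} (hG : IsFull G) :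
    G.edgeSet.ncard = 2 ^ n + ((layer G false).ncard + (layer G true).ncard) := by
  rw [hG.edgeSet_eq, Set.ncard_union_eq, Set.ncard_union_eq (disjoint_image_lift _ _),
    ncard_range_vertical, ncard_image_lift, ncard_image_lift]
  rw [Set.disjoint_left]
  rintro _ ⟨X, rfl⟩ (⟨e, -, h⟩ | ⟨e, -, h⟩) <;> exact map_lift_ne_vertical _ _ _ h

/-- Used in place of graph homomorphisms, because the maps below may collapse an edge to a vertex or
replace it by a path. -/
theorem reachable_of_adj_reachable {V W : Type*} {G : SimpleGraph V} {H : SimpleGraph W}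
    (f : V → W) (h : ∀ a b, G.Adj a b → H.Reachable (f a) (f b)) {a b : V}
    (hab : G.Reachable a b) : H.Reachable (f a) (f b) := by
  obtain ⟨p⟩ := hab
  induction p with
  | nil => rfl
  | cons hadj _ ih => exact (h _ _ hadj).trans ih

theorem IsFull.reachable_lift {G : SimpleGraph (Finset (Fin (n + 1)))} (hG : IsFull G)
    (b c : Bool) (X : Finset (Fin n)) : G.Reachable (lift b X) (lift c X) := by
  have h : G.Adj (lift false X) (lift true X) := hG.vertical_mem X
  cases b <;> cases c
  · rfl
  · exact h.reachable
  · exact h.symm.reachable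
  · rfl

/-- Projection collapses vertical edges and keeps the others. Conversely, a walk in the contraction
lifts by changing layers along vertical edges whenever needed. -/
theorem IsFull.connected_iff {G : SimpleGraph (Finset (Fin (n + 1)))} (hG : IsFull G) :
    G.Connected ↔ (contract G).Connected := by
  constructor
  · intro h
    refine (SimpleGraph.connected_iff _).2 ⟨fun X Y => ?_, inferInstance⟩
    have := reachable_of_adj_reachable (H := contract G) proj ?_
      (h.preconnected (lift false X) (lift false Y))
    · simpa using this
    · intro A B hAB
      have hAB' : s(A, B) ∈ G.edgeSet := hAB
      obtain ⟨b, X, rfl⟩ := exists_eq_lift A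
      obtain ⟨c, Y, rfl⟩ := exists_eq_lift B
      rw [proj_lift, proj_lift]
      by_cases hbc : b = c
      · subst hbc
        exact (contract_adj.2 ⟨b, hAB⟩).reachable
      · obtain ⟨i, hi⟩ := hG.le hAB
        rw [symmDiff_lift] at hi
        induction i using Fin.lastCases with
        | last =>
          rw [singleton_last, lift_inj, ← Finset.bot_eq_empty, symmDiff_eq_bot] at hi
          rw [hi.2]
        | cast i =>
          rw [singleton_castSucc, lift_inj] at hi
          exact absurd (by simpa using hi.1) hbc
  · intro h
    refine (SimpleGraph.connected_iff _).2 ⟨fun A B => ?_, inferInstance⟩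
    obtain ⟨b, X, rfl⟩ := exists_eq_lift A
    obtain ⟨c, Y, rfl⟩ := exists_eq_lift B
    refine (hG.reachable_lift b false X).trans (.trans ?_ (hG.reachable_lift false c Y))
    refine reachable_of_adj_reachable (lift false) (fun Z W hZW => ?_) (h.preconnected X Y)
    obtain ⟨d, hd⟩ := contract_adj.1 hZW
    exact (hG.reachable_lift false d Z).trans (hd.reachable.trans (hG.reachable_lift d false W))

/-- A subgraph of `Q_{n+1}` containing all edges in the last direction is a spanning tree iff its
layers are disjoint and contracting the last direction gives a spanning tree. -/
theorem IsFull.isTree_iff {G : SimpleGraph (Finset (Fin (n + 1)))} (hG : IsFull G) :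
    G.IsTree ↔ (contract G).IsTree ∧ Disjoint (layer G false) (layer G true) := by
  rw [SimpleGraph.isTree_iff_connected_and_card, SimpleGraph.isTree_iff_connected_and_card,
    hG.connected_iff, Nat.card_coe_set_eq, Nat.card_coe_set_eq, hG.ncard_edgeSet]
  -- The contraction has `|L₀ ∪ L₁|` edges and `G` has `2 ^ n + |L₀| + |L₁|`. If `G` is a tree then
  -- `|L₀| + |L₁| = 2 ^ n - 1`, while connectedness requires `|L₀ ∪ L₁| ≥ 2 ^ n - 1`; so the
  -- intersection is empty.
  have hcard := Set.ncard_union_add_ncard_inter (layer G false) (layer G true)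
  have hedge := congrArg Set.ncard (edgeSet_contract G)
  simp only [Nat.card_eq_fintype_card, Fintype.card_finset, Fintype.card_fin, pow_succ]
  constructor
  · rintro ⟨hc, h⟩
    have hle := hc.card_vert_le_card_edgeSet_add_one
    simp only [Nat.card_eq_fintype_card, Fintype.card_finset, Fintype.card_fin] at hle
    rw [Nat.card_coe_set_eq] at hle
    refine ⟨⟨hc, by omega⟩, ?_⟩
    rw [Set.disjoint_iff_inter_eq_empty, ← Set.ncard_eq_zero]
    omega
  · rintro ⟨⟨hc, h⟩, hd⟩
    rw [Set.disjoint_iff_inter_eq_empty, ← Set.ncard_eq_zero] at hd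
    exact ⟨hc, by omega⟩

/-! ### Signatures under contraction -/

theorem isFull_iff_sig_last (T : SpanningTree (n + 1)) :
    IsFull T.1 ↔ sig T (Fin.last n) = 2 ^ n := by
  have hsub : {e | e ∈ T.1.edgeSet ∧ HasDirection e (Fin.last n)} ⊆ Set.range vertical :=
    fun e he => hasDirection_last_iff.1 he.2
  constructor
  · intro h
    rw [sig, ← ncard_range_vertical]
    congr 1
    refine hsub.antisymm ?_
    rintro _ ⟨X, rfl⟩
    exact ⟨h.vertical_mem X, hasDirection_last_iff.2 ⟨X, rfl⟩⟩
  · intro h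
    refine ⟨T.2.1, fun X => ?_⟩
    have := Set.eq_of_subset_of_ncard_le hsub (by rw [ncard_range_vertical]; exact h.ge)
    exact (this.ge ⟨X, rfl⟩).1

/-- The spanning tree of `Q_n` obtained from a spanning tree of `Q_{n+1}` with all edges in the
last direction by contracting these edges. -/
def contractTree (T : SpanningTree (n + 1)) (hT : IsFull T.1) : SpanningTree n :=
  ⟨contract T.1, contract_le T.2.1, (hT.isTree_iff.1 T.2.2).1⟩

/-- Disjointness of the layers means that contraction merges no two edges. -/
theorem sig_contractTree (T : SpanningTree (n + 1)) (hT : IsFull T.1) (i : Fin n) :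
    sig (contractTree T hT) i = sig T i.castSucc := by
  have hd := (hT.isTree_iff.1 T.2.2).2
  have h₁ : {e | e ∈ (contractTree T hT).1.edgeSet ∧ HasDirection e i} =
      {e | e ∈ layer T.1 false ∧ HasDirection e i} ∪
        {e | e ∈ layer T.1 true ∧ HasDirection e i} := by
    ext e
    simp only [contractTree, mem_contract, Bool.exists_bool, Set.mem_ofPred_eq, Set.mem_union]
    tauto
  have h₂ : {e | e ∈ T.1.edgeSet ∧ HasDirection e i.castSucc} =
      Sym2.map (lift false) '' {e | e ∈ layer T.1 false ∧ HasDirection e i} ∪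
        Sym2.map (lift true) '' {e | e ∈ layer T.1 true ∧ HasDirection e i} := by
    ext e
    constructor
    · rintro ⟨he, hi⟩
      obtain ⟨b, f, hf, rfl⟩ := hasDirection_castSucc_iff.1 hi
      cases b
      · exact Or.inl ⟨f, ⟨he, hf⟩, rfl⟩
      · exact Or.inr ⟨f, ⟨he, hf⟩, rfl⟩
    · rintro (⟨f, ⟨hf, hi⟩, rfl⟩ | ⟨f, ⟨hf, hi⟩, rfl⟩) <;>
        exact ⟨hf, hasDirection_map_lift.2 hi⟩
  rw [sig, sig, h₁, h₂, Set.ncard_union_eq (disjoint_image_lift _ _), ncard_image_lift,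
    ncard_image_lift, Set.ncard_union_eq]
  exact hd.mono (fun _ h => h.1) (fun _ h => h.1)

/-! ### Trees with prescribed layers -/

/-- The subgraph of `Q_{n+1}` with all edges in the last direction and with given layers. -/
def join (E : Bool → SimpleGraph (Finset (Fin n))) : SimpleGraph (Finset (Fin (n + 1))) where
  Adj A B := (proj A = proj B ∧ A ≠ B) ∨
    ((Fin.last n ∈ A ↔ Fin.last n ∈ B) ∧ (E (decide (Fin.last n ∈ A))).Adj (proj A) (proj B))
  symm := ⟨by
    rintro A B (⟨h, h'⟩ | ⟨h, h'⟩)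
    · exact Or.inl ⟨h.symm, h'.symm⟩
    · refine Or.inr ⟨h.symm, ?_⟩
      rw [← decide_eq_decide.2 h]
      exact h'.symm⟩
  loopless := ⟨by
    rintro A (⟨-, h⟩ | ⟨-, h⟩)
    · exact h rfl
    · exact h.ne rfl⟩

theorem layer_join (E : Bool → SimpleGraph (Finset (Fin n))) (b : Bool) :
    layer (join E) b = (E b).edgeSet := by
  ext e
  induction e using Sym2.ind with
  | _ X Y =>
    simp only [mem_layer, Sym2.map_mk, SimpleGraph.mem_edgeSet, join]
    simp

theorem isFull_join {E : Bool → SimpleGraph (Finset (Fin n))} (hE : ∀ b, E b ≤ cube n) :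
    IsFull (join E) := by
  constructor
  · rintro A B h
    obtain ⟨a, X, rfl⟩ := exists_eq_lift A
    obtain ⟨b, Y, rfl⟩ := exists_eq_lift B
    simp only [join, proj_lift, last_mem_lift, ne_eq, lift_inj] at h
    rcases h with ⟨rfl, h⟩ | ⟨h, h'⟩
    · refine ⟨Fin.last n, ?_⟩
      rw [symmDiff_lift, symmDiff_self, singleton_last, Finset.bot_eq_empty, lift_inj]
      exact ⟨by cases a <;> cases b <;> simp at h ⊢, rfl⟩
    · obtain rfl : a = b := Bool.eq_iff_iff.2 h
      obtain ⟨i, hi⟩ := hE _ h'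
      exact ⟨i.castSucc, by simp [symmDiff_lift, hi, singleton_castSucc]⟩
  · intro X
    simp [vertical, join]

theorem eq_of_layer_eq {G H : SimpleGraph (Finset (Fin (n + 1)))} (hG : IsFull G) (hH : IsFull H)
    (h : ∀ b, layer G b = layer H b) : G = H := by
  rw [← SimpleGraph.edgeSet_inj, hG.edgeSet_eq, hH.edgeSet_eq, h, h]

/-- Both graphs contain the same vertical edges, so an exchange of non-vertical edges can be checked
layer by layer. -/
theorem edgeSet_eq_insert_sdiff_iff {G H : SimpleGraph (Finset (Fin (n + 1)))} (hG : IsFull G)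
    (hH : IsFull H) {e f : Sym2 (Finset (Fin n))} {b c : Bool} :
    H.edgeSet = insert (f.map (lift c)) (G.edgeSet \ {e.map (lift b)}) ↔
      ∀ a x, x ∈ layer H a ↔ (a = c ∧ x = f) ∨ (x ∈ layer G a ∧ ¬(a = b ∧ x = e)) := by
  constructor
  · intro h a x
    rw [mem_layer, h]
    simp [map_lift_inj, mem_layer]
  · intro h
    ext y
    have key : ∀ a x, y = Sym2.map (lift a) x → (y ∈ H.edgeSet ↔
        y ∈ insert (f.map (lift c)) (G.edgeSet \ {e.map (lift b)})) := by
      rintro a x rfl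
      rw [← mem_layer, h]
      simp [map_lift_inj, mem_layer]
    by_cases hy : ∃ a x, y = Sym2.map (lift a) x
    · obtain ⟨a, x, hx⟩ := hy
      exact key a x hx
    · push Not at hy
      have hvert : ∀ {K : SimpleGraph (Finset (Fin (n + 1)))}, IsFull K →
          (y ∈ K.edgeSet ↔ y ∈ Set.range vertical) := by
        intro K hK
        constructor
        · intro hyK
          obtain ⟨i, hi⟩ := hasDirection_of_mem hK.le hyK
          rcases eq_vertical_or_eq_map_lift hi with h' | ⟨a, x, h'⟩
          · exact h'
          · exact absurd h' (hy a x)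
        · rintro ⟨X, rfl⟩
          exact hK.vertical_mem X
      rw [Set.mem_insert_iff, Set.mem_sdiff, Set.mem_singleton_iff, hvert hG, hvert hH]
      simp [hy]

theorem exists_spanningTree_layer {E : Bool → SimpleGraph (Finset (Fin n))}
    (hE : ∀ b, E b ≤ cube n) (hd : Disjoint (E false).edgeSet (E true).edgeSet)
    (ht : (E false ⊔ E true).IsTree) :
    ∃ T : SpanningTree (n + 1), IsFull T.1 ∧ (∀ b, layer T.1 b = (E b).edgeSet) ∧
      contract T.1 = E false ⊔ E true := by
  have hfull := isFull_join hE
  have hc : contract (join E) = E false ⊔ E true := by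
    rw [← SimpleGraph.edgeSet_inj, edgeSet_contract, layer_join, layer_join,
      SimpleGraph.edgeSet_sup]
  refine ⟨⟨join E, hfull.le, hfull.isTree_iff.2 ⟨hc ▸ ht, ?_⟩⟩, hfull, layer_join E, hc⟩
  rwa [layer_join, layer_join]

theorem sig_eq_of_contractTree {S : Fin (n + 1) → ℕ} (hS : S (Fin.last n) = 2 ^ n)
    {T : SpanningTree (n + 1)} (hT : IsFull T.1)
    (h : sig (contractTree T hT) = fun i => S i.castSucc) : sig T = S := by
  funext i
  induction i using Fin.lastCases with
  | last => rw [hS]; exact (isFull_iff_sig_last T).1 hT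
  | cast i => rw [← sig_contractTree T hT, h]

/-- The spanning tree of `Q_{n+1}` with all edges in the last direction and all other edges in the
lower layer. -/
theorem exists_lowerTree (T : SpanningTree n) :
    ∃ U : SpanningTree (n + 1), ∃ hU : IsFull U.1,
      layer U.1 true = ∅ ∧ contractTree U hU = T := by
  obtain ⟨U, hU, hl, hc⟩ := exists_spanningTree_layer
    (E := fun b => bif b then ⊥ else T.1) (by rintro (_ | _); exacts [T.2.1, bot_le])
    (by simp) (by simpa using T.2.2)
  refine ⟨U, hU, by simp [hl], Subtype.ext ?_⟩
  simpa [contractTree] using hc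

/-! ### Edge slides and contraction -/

/-- An edge slide between spanning trees of `Q_{n+1}` with all edges in the last direction
contracts to an edge slide or to the identity. -/
theorem IsSlide.contractTree {T U : SpanningTree (n + 1)} (hT : IsFull T.1) (hU : IsFull U.1)
    {e : Sym2 (Finset (Fin (n + 1)))} {i : Fin (n + 1)} (h : IsSlide T U e i) :
    contractTree T hT = contractTree U hU ∨
      (edgeSlideGraph n).Adj (contractTree T hT) (contractTree U hU) := by
  obtain ⟨he, ⟨j, hji, hj⟩, hf, hE⟩ := h
  have hdT := Set.disjoint_left.1 (hT.isTree_iff.1 T.2.2).2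
  have hdU := Set.disjoint_left.1 (hU.isTree_iff.1 U.2.2).2
  induction j using Fin.lastCases with
  | last =>
    -- A vertical edge cannot slide: its image is vertical, hence already in `T`.
    have := hj.flipEdge i
    obtain ⟨X, hX⟩ := hasDirection_last_iff.1 this
    exact absurd (hX ▸ hT.vertical_mem X) hf
  | cast j =>
    obtain ⟨b, f, hfj, rfl⟩ := hasDirection_castSucc_iff.1 hj
    induction i using Fin.lastCases with
    | last =>
      -- The edge `f` only changes layer, so the union of the layers is unchanged.
      left
      rw [flipEdge_last_map_lift, edgeSet_eq_insert_sdiff_iff hT hU] at hE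
      apply Subtype.ext
      rw [← SimpleGraph.edgeSet_inj]
      ext x
      have he' : f ∈ layer T.1 b := he
      have h₀ := hE false x
      have h₁ := hE true x
      simp only [CubeTree.contractTree, mem_contract, Bool.exists_bool, h₀, h₁]
      by_cases hx : x = f
      · subst hx
        cases b <;> simp [he']
      · simp [hx]
    | cast i =>
      right
      rw [flipEdge_castSucc_map_lift] at hf
      rw [flipEdge_castSucc_map_lift, edgeSet_eq_insert_sdiff_iff hT hU] at hE
      have he' : f ∈ layer T.1 b := he
      have hf' : flipEdge i f ∉ layer T.1 b := hf
      have hne : flipEdge i f ≠ f := fun h' => hf' (h'.symm ▸ he')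
      have hU₁ : flipEdge i f ∈ layer U.1 b := (hE _ _).2 (Or.inl ⟨rfl, rfl⟩)
      have hT₁ : f ∉ layer T.1 !b := by
        cases b
        · exact hdT he'
        · exact fun h' => hdT h' he'
      -- The new edge must be absent from the other layer too. If it were there in `T` it would
      -- remain in `U`, whose layers would then meet.
      have hU₂ : flipEdge i f ∉ layer U.1 !b := by
        cases b
        · exact hdU hU₁
        · exact fun h' => hdU h' hU₁
      have hT₂ : flipEdge i f ∉ layer T.1 !b := fun h' =>
        hU₂ ((hE _ _).2 (Or.inr ⟨h', fun h'' => hne h''.2⟩))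
      refine ⟨f, i, mem_contract.2 ⟨b, he'⟩, ⟨j, ?_, hfj⟩, ?_, ?_⟩
      · exact fun h' => hji (congrArg _ h')
      · rintro h'
        obtain ⟨c, hc⟩ := mem_contract.1 h'
        cases b <;> cases c <;> contradiction
      · ext x
        have h₀ := hE false x
        have h₁ := hE true x
        simp only [CubeTree.contractTree, mem_contract, Bool.exists_bool, h₀, h₁,
          Set.mem_insert_iff, Set.mem_sdiff, Set.mem_singleton_iff]
        by_cases hx : x = f
        · subst hx
          cases b <;> simp_all
        · cases b <;> simp [hx, or_assoc, or_left_comm]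

/-- An edge slide between spanning trees of `Q_n` lifts to the trees whose upper layer is empty. -/
theorem adj_of_adj_contractTree {T U : SpanningTree (n + 1)} (hT : IsFull T.1)
    (hU : IsFull U.1) (hT₀ : layer T.1 true = ∅) (hU₀ : layer U.1 true = ∅)
    (h : (edgeSlideGraph n).Adj (contractTree T hT) (contractTree U hU)) :
    (edgeSlideGraph (n + 1)).Adj T U := by
  obtain ⟨e, i, he, ⟨j, hji, hj⟩, hf, hE⟩ := h
  simp only [contractTree, edgeSet_contract, hT₀, hU₀, Set.union_empty] at he hf hE
  refine ⟨e.map (lift false), i.castSucc, he, ⟨j.castSucc, ?_, hasDirection_map_lift.2 hj⟩, ?_, ?_⟩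
  · exact fun h => hji (Fin.castSucc_injective n h)
  · rwa [flipEdge_castSucc_map_lift]
  · rw [flipEdge_castSucc_map_lift, edgeSet_eq_insert_sdiff_iff hT hU]
    rintro (_ | _) x
    · simp [hE]
    · simp [hT₀, hU₀]

/-- The layers are disjoint, so the place below `e` is free; moving `e` there keeps the union, hence
the tree property. -/
theorem exists_slide_down {T : SpanningTree (n + 1)} (hT : IsFull T.1)
    {e : Sym2 (Finset (Fin n))} (he : e ∈ layer T.1 true) :
    ∃ U : SpanningTree (n + 1), ∃ hU : IsFull U.1, contractTree U hU = contractTree T hT ∧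
      layer U.1 true = layer T.1 true \ {e} ∧ (edgeSlideGraph (n + 1)).Adj T U := by
  have hd := (hT.isTree_iff.1 T.2.2).2
  have hcube : (contract T.1) ≤ cube n := contract_le T.2.1
  have hec : e ∈ (contract T.1).edgeSet := mem_contract.2 ⟨true, he⟩
  -- `SimpleGraph.fromEdgeSet` discards diagonal elements; this shows that none occur.
  have hnd : ∀ {x b}, x ∈ layer T.1 b → ¬ x.IsDiag := fun {x b} hx =>
    SimpleGraph.not_isDiag_of_mem_edgeSet _ (mem_contract.2 ⟨b, hx⟩)
  let E : Bool → SimpleGraph (Finset (Fin n)) := fun b =>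
    SimpleGraph.fromEdgeSet (bif b then layer T.1 true \ {e} else insert e (layer T.1 false))
  have hE₀ : (E false).edgeSet = insert e (layer T.1 false) := by
    simp only [E, cond_false, SimpleGraph.edgeSet_fromEdgeSet]
    refine sdiff_eq_left.2 (Set.disjoint_left.2 ?_)
    rintro x (rfl | hx)
    exacts [hnd he, hnd hx]
  have hE₁ : (E true).edgeSet = layer T.1 true \ {e} := by
    simp only [E, cond_true, SimpleGraph.edgeSet_fromEdgeSet]
    refine sdiff_eq_left.2 (Set.disjoint_left.2 ?_)
    rintro x ⟨hx, -⟩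
    exact hnd hx
  have hsup : E false ⊔ E true = contract T.1 := by
    rw [← SimpleGraph.edgeSet_inj, SimpleGraph.edgeSet_sup, hE₀, hE₁, edgeSet_contract]
    ext x
    by_cases hx : x = e
    · subst hx; simp [he]
    · simp [hx]
  obtain ⟨U, hU, hl, hc⟩ := exists_spanningTree_layer (E := E)
    (by rintro (_ | _)
        exacts [le_sup_left.trans (hsup.le.trans hcube), le_sup_right.trans (hsup.le.trans hcube)])
    (by
      rw [hE₀, hE₁, Set.disjoint_left]
      rintro x (rfl | hx) ⟨hx', hxe⟩
      · exact hxe rfl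
      · exact Set.disjoint_left.1 hd hx hx')
    (hsup ▸ (hT.isTree_iff.1 T.2.2).1)
  have he₀ : e ∉ layer T.1 false := fun h => Set.disjoint_left.1 hd h he
  obtain ⟨i, hi⟩ := hasDirection_of_mem hcube hec
  refine ⟨U, hU, Subtype.ext (hc.trans hsup), (hl true).trans hE₁, e.map (lift true), Fin.last n,
    he, ⟨i.castSucc, Fin.castSucc_ne_last i, hasDirection_map_lift.2 hi⟩, ?_, ?_⟩
  · rwa [flipEdge_last_map_lift]
  · rw [flipEdge_last_map_lift, edgeSet_eq_insert_sdiff_iff hT hU]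
    rintro (_ | _) x
    · simp [hl, hE₀]
    · simp [hl, hE₁]

/-! ### Removing one full direction -/

theorem isFull_of_sig_eq {S : Fin (n + 1) → ℕ} (hS : S (Fin.last n) = 2 ^ n)
    {T : SpanningTree (n + 1)} (hT : sig T = S) : IsFull T.1 :=
  (isFull_iff_sig_last T).2 (by rw [hT, hS])

theorem sig_contractTree_eq {S : Fin (n + 1) → ℕ} {T : SpanningTree (n + 1)} (hfull : IsFull T.1)
    (hT : sig T = S) : sig (contractTree T hfull) = fun i => S i.castSucc := by
  funext i
  rw [sig_contractTree, hT]

/-- Every spanning tree with all edges in the last direction can be moved, by edge slides in the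
last direction, to the one with empty upper layer and the same contraction. -/
theorem reachable_of_contractTree_eq {S : Fin (n + 1) → ℕ} (hS : S (Fin.last n) = 2 ^ n)
    {U : SpanningTree (n + 1)} (hU : sig U = S) (hfU : IsFull U.1) (hU₀ : layer U.1 true = ∅)
    (k : ℕ) : ∀ (T : SpanningTree (n + 1)) (hT : sig T = S) (hfT : IsFull T.1),
      (layer T.1 true).ncard = k → contractTree T hfT = contractTree U hfU →
      (edgeSlideGraphSig S).Reachable ⟨T, hT⟩ ⟨U, hU⟩ := by
  induction k with
  | zero =>
    intro T hT hfT hk hc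
    have hT₀ : layer T.1 true = ∅ := (Set.ncard_eq_zero).1 hk
    have hc' := congrArg (fun W : SpanningTree n => W.1.edgeSet) hc
    simp only [contractTree, edgeSet_contract, hT₀, hU₀, Set.union_empty] at hc'
    have : T = U := Subtype.ext <| eq_of_layer_eq hfT hfU <| by
      rintro (_ | _)
      exacts [hc', hT₀.trans hU₀.symm]
    subst this
    rfl
  | succ k ih =>
    intro T hT hfT hk hc
    obtain ⟨e, he⟩ : (layer T.1 true).Nonempty := by
      rw [← Set.ncard_pos]
      omega
    obtain ⟨W, hfW, hcW, hlW, hadj⟩ := exists_slide_down hfT he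
    -- The slide stays inside the induced subgraph: fullness and the contraction determine the
    -- signature.
    have hW : sig W = S :=
      sig_eq_of_contractTree hS hfW (by rw [hcW, sig_contractTree_eq hfT hT])
    have hadj' : (edgeSlideGraphSig S).Adj ⟨T, hT⟩ ⟨W, hW⟩ := hadj
    refine hadj'.reachable.trans (ih W hW hfW ?_ (hcW.trans hc))
    rw [hlW, Set.ncard_sdiff_singleton_of_mem he, hk, Nat.add_sub_cancel]

/-- Contraction `p` and the section `g` with empty upper layers both preserve reachability, `p ∘ g`
is the identity, and `g ∘ p` moves each tree within its component. -/
theorem connected_iff_of_last {S : Fin (n + 1) → ℕ} (hS : S (Fin.last n) = 2 ^ n) :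
    (edgeSlideGraphSig S).Connected ↔
      (edgeSlideGraphSig fun i : Fin n => S i.castSucc).Connected := by
  have hlow : ∀ T : {T : SpanningTree n | sig T = fun i => S i.castSucc},
      ∃ U : {U : SpanningTree (n + 1) | sig U = S}, ∃ hU : IsFull U.1.1,
        layer U.1.1 true = ∅ ∧ contractTree U.1 hU = T.1 := by
    rintro ⟨T, hT⟩
    obtain ⟨U, hU, h₀, hc⟩ := exists_lowerTree T
    exact ⟨⟨U, sig_eq_of_contractTree hS hU (by rw [hc]; exact hT)⟩, hU, h₀, hc⟩
  choose g hg hg₀ hgc using hlow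
  let p : {U : SpanningTree (n + 1) | sig U = S} →
      {T : SpanningTree n | sig T = fun i => S i.castSucc} := fun U =>
    ⟨contractTree U.1 (isFull_of_sig_eq hS U.2), sig_contractTree_eq _ U.2⟩
  have hpg : ∀ T, p (g T) = T := fun T => Subtype.ext (hgc T)
  have hgp : ∀ U, (edgeSlideGraphSig S).Reachable U (g (p U)) := fun U =>
    reachable_of_contractTree_eq hS (g (p U)).2 (hg _) (hg₀ _) _ U.1 U.2
      (isFull_of_sig_eq hS U.2) rfl (hgc (p U)).symm
  simp only [SimpleGraph.connected_iff]
  constructor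
  · rintro ⟨h, ⟨U⟩⟩
    refine ⟨fun T T' => ?_, ⟨p U⟩⟩
    rw [← hpg T, ← hpg T']
    refine reachable_of_adj_reachable p ?_ (h _ _)
    rintro A B ⟨e, i, hAB⟩
    rcases hAB.contractTree (isFull_of_sig_eq hS A.2) (isFull_of_sig_eq hS B.2) with h' | h'
    · have : p A = p B := Subtype.ext h'
      rw [this]
    · exact SimpleGraph.Adj.reachable h'
  · rintro ⟨h, ⟨T⟩⟩
    refine ⟨fun U U' => (hgp U).trans (.trans ?_ (hgp U').symm), ⟨g T⟩⟩
    refine reachable_of_adj_reachable g ?_ (h _ _)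
    intro A B hAB
    have hadj : (edgeSlideGraph (n + 1)).Adj (g A).1 (g B).1 := by
      refine adj_of_adj_contractTree (hg A) (hg B) (hg₀ A) (hg₀ B) ?_
      rw [hgc, hgc]
      exact hAB
    exact SimpleGraph.Adj.reachable hadj

/-! ### Excess of ordered tuples and the induction -/

theorem le_apply_of_strictMono {k : ℕ} {f : Fin k → Fin n} (hf : StrictMono f) (i : ℕ) :
    ∀ hi : i < k, i ≤ (f ⟨i, hi⟩ : ℕ) := by
  induction i with
  | zero => exact fun _ => Nat.zero_le _
  | succ i ih =>
    intro hi
    have h : f ⟨i, by omega⟩ < f ⟨i + 1, hi⟩ := hf (Fin.mk_lt_mk.2 i.lt_succ_self)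
    exact (ih (by omega)).trans_lt h

/-- In increasing order, the element of `K` at position `i` is at least `i`, so the sums compare
term by term. -/
theorem sum_initial_le {S : Fin n → ℕ} (hS : IsOrdered S) {k : ℕ} (hk : k ≤ n)
    {K : Finset (Fin n)} (hK : K.card = k) : ∑ i, initial S k hk i ≤ ∑ i ∈ K, S i := by
  rw [← Finset.map_orderEmbOfFin_univ K hK, Finset.sum_map]
  refine Finset.sum_le_sum fun i _ => hS _ _ ?_
  exact le_apply_of_strictMono (K.orderEmbOfFin hK).strictMono i i.2

theorem excess_of_isOrdered {S : Fin n → ℕ} (hS : IsOrdered S) {k : ℕ} (hk : k ≤ n) :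
    excess S k = ((∑ i, initial S k hk i : ℕ) : ℤ) - (2 ^ k - 1) := by
  have : sInf {m : ℕ | ∃ K : Finset (Fin n), K.card = k ∧ ∑ i ∈ K, S i = m} =
      ∑ i, initial S k hk i := by
    have hmem : ∑ i, initial S k hk i ∈
        {m : ℕ | ∃ K : Finset (Fin n), K.card = k ∧ ∑ i ∈ K, S i = m} :=
      ⟨Finset.univ.map (Fin.castLEEmb hk), by simp, by simp [initial]⟩
    refine le_antisymm (Nat.sInf_le hmem) (le_csInf ⟨_, hmem⟩ ?_)
    rintro m ⟨K, hK, rfl⟩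
    exact sum_initial_le hS hk hK
  rw [excess, this]

/-- Subtract consecutive initial sums: `(2 ^ (k + 1) - 1) - (2 ^ k - 1) = 2 ^ k`. Since indices
start at `0`, `Fin.last k` is direction `k + 1`. -/
theorem SaturatedAbove.apply_eq {S : Fin n → ℕ} (hS : IsOrdered S) {r : ℕ}
    (h : SaturatedAbove S r) {k : ℕ} (hrk : r ≤ k) (hk : k + 1 ≤ n) :
    initial S (k + 1) hk (Fin.last k) = 2 ^ k := by
  have h₁ := h k hrk (by omega)
  have h₂ := h (k + 1) (by omega) hk
  rw [excess_of_isOrdered hS (by omega)] at h₁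
  rw [excess_of_isOrdered hS hk, Fin.sum_univ_castSucc] at h₂
  have h₃ : ∑ i : Fin k, initial S (k + 1) hk i.castSucc = ∑ i, initial S k (by omega) i := rfl
  rw [h₃, pow_succ] at h₂
  push_cast at h₁ h₂
  zify
  linarith

theorem SaturatedAbove.connected_iff {S : Fin n → ℕ} (hS : IsOrdered S) {r : ℕ} (hr : r ≤ n)
    (h : SaturatedAbove S r) :
    (edgeSlideGraphSig S).Connected ↔ (edgeSlideGraphSig (initial S r hr)).Connected := by
  have key : ∀ k, r ≤ k → ∀ hk : k ≤ n, (edgeSlideGraphSig (initial S k hk)).Connected ↔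
      (edgeSlideGraphSig (initial S r hr)).Connected := by
    intro k hrk
    induction k, hrk using Nat.le_induction with
    | base => exact fun _ => Iff.rfl
    | succ k hrk ih =>
      intro hk
      -- Dropping the last entry of `initial S (k + 1) hk` gives `initial S k _` definitionally.
      exact (connected_iff_of_last (h.apply_eq hS hrk hk)).trans (ih (by omega))
  exact key n hr le_rfl

end CubeTree

theorem theorem8p3 {n : ℕ} (S : Fin n → ℕ) (hS : CubeTree.IsSignature S)
    (hord : CubeTree.IsOrdered S) (r : ℕ) (hr : 1 ≤ r) (hrn : r ≤ n)
    (hsat : CubeTree.SaturatedAbove S r) :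
    ((CubeTree.edgeSlideGraphSig S).Connected ↔
      (CubeTree.edgeSlideGraphSig (CubeTree.initial S r hrn)).Connected) ∧
    ((CubeTree.edgeSlideGraphSig S).Connected ↔
      (CubeTree.edgeSlideGraphSig (CubeTree.unsat S)).Connected) := by
  -- The set contains `r`, so the infimum is attained and is not the default value `0`.
  have hmem : CubeTree.unsatIndex S ∈
      {s : ℕ | 1 ≤ s ∧ s ≤ n ∧ CubeTree.SaturatedAbove S s} :=
    Nat.sInf_mem ⟨r, hr, hrn, hsat⟩
  exact ⟨hsat.connected_iff hord hrn, hmem.2.2.connected_iff hord hmem.2.1⟩
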